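/- Let $F$ be a field of characteristic zero and let $R$ be a finite-dimensional (right) Leibniz algebra over $F$, that is, a finite-dimensional vector space with a bilinear bracket such that $[x,[y,z]]=[[x,y],z]-[[x,z],y]$ for all $x,y,z\in R$. Assume that $R$ is solvable, let $N$ be its nilradical (the maximal nilpotent two-sided ideal of $R$), and let $Q$ be a vector subspace of $R$ with $R=N\oplus Q$. Derivations $d_1,\dots,d_n$ of $N$ are called nil-independent if, for $\alpha_1,\dots,\alpha_n\in F$, the linear combination $\alpha_1d_1+\dots+\alpha_nd_n$ is nilpotent only when $\alpha_1=\dots=\alpha_n=0$. Then there is a maximal number of nil-independent derivations of $N$, and $\dim Q$ is at most this number. Moreover, for every nonzero $x\in Q$, the map $N\to N$, $y\mapsto[y,x]$, is a derivation of $N$ that is not nilpotent. -/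

import Mathlib

/-- An additive group with a biadditive bracket satisfying the (right) Leibniz identity
`[x, [y, z]] = [[x, y], z] - [[x, z], y]`. -/
class LeibnizRing (L : Type*) extends AddCommGroup L, Bracket L L where
  protected add_bracket : ∀ x y z : L, ⁅x + y, z⁆ = ⁅x, z⁆ + ⁅y, z⁆
  protected bracket_add : ∀ x y z : L, ⁅x, y + z⁆ = ⁅x, y⁆ + ⁅x, z⁆
  protected leibniz_identity : ∀ x y z : L, ⁅x, ⁅y, z⁆⁆ = ⁅⁅x, y⁆, z⁆ - ⁅⁅x, z⁆, y⁆

/-- A Leibniz algebra over a field `F`: an `F`-vector space with an `F`-bilinear bracket that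
satisfies the Leibniz identity. -/
class LeibnizAlgebra (F L : Type*) [Field F] [LeibnizRing L] [Module F L] : Prop where
  protected smul_bracket : ∀ (c : F) (x y : L), ⁅c • x, y⁆ = c • ⁅x, y⁆
  protected bracket_smul : ∀ (c : F) (x y : L), ⁅x, c • y⁆ = c • ⁅x, y⁆

/-- Two-sided ideals: subspaces `I` with `[L, I] ⊆ I` and `[I, L] ⊆ I`. -/
structure LeibnizIdeal (F L : Type*) [Field F] [LeibnizRing L] [Module F L] extends
    Submodule F L where
  bracket_mem_right : ∀ (x : L) {y : L}, y ∈ carrier → ⁅x, y⁆ ∈ carrier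
  bracket_mem_left : ∀ {x : L} (y : L), x ∈ carrier → ⁅x, y⁆ ∈ carrier

namespace LeibnizIdeal

variable {F L : Type*} [Field F] [LeibnizRing L] [Module F L]

/-- An ideal is a Leibniz ring under the restricted bracket. -/
instance instLeibnizRing (I : LeibnizIdeal F L) : LeibnizRing I.toSubmodule where
  bracket x y := ⟨⁅(x : L), (y : L)⁆, I.bracket_mem_right _ y.2⟩
  add_bracket x y z := Subtype.ext (LeibnizRing.add_bracket (x : L) y z)
  bracket_add x y z := Subtype.ext (LeibnizRing.bracket_add (x : L) y z)
  leibniz_identity x y z := Subtype.ext (LeibnizRing.leibniz_identity (x : L) y z)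

theorem coe_bracket (I : LeibnizIdeal F L) (x y : I.toSubmodule) :
    ((⁅x, y⁆ : I.toSubmodule) : L) = ⁅(x : L), (y : L)⁆ := rfl

/-- An ideal of a Leibniz algebra is itself a Leibniz algebra. -/
instance instLeibnizAlgebra [LeibnizAlgebra F L] (I : LeibnizIdeal F L) :
    LeibnizAlgebra F I.toSubmodule where
  smul_bracket c x y := Subtype.ext (LeibnizAlgebra.smul_bracket c (x : L) y)
  bracket_smul c x y := Subtype.ext (LeibnizAlgebra.bracket_smul c (x : L) y)

end LeibnizIdeal

namespace LeibnizAlgebra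

section

variable {F L : Type*} [Field F] [LeibnizRing L] [Module F L]

/-- The commutator `[H, K]`: the span of all brackets `[h, k]` and `[k, h]` with `h ∈ H`, `k ∈ K`.
When `H` and `K` are two-sided ideals this span is a two-sided ideal. -/
def commutator (H K : Submodule F L) : Submodule F L :=
  Submodule.span F {z | ∃ h ∈ H, ∃ k ∈ K, z = ⁅h, k⁆ ∨ z = ⁅k, h⁆}

variable (F L) in
/-- The lower central series `L, [L, L], [[L, L], L], …`, indexed from `0`. -/
def lowerCentral : ℕ → Submodule F L
  | 0 => ⊤
  | k + 1 => commutator (lowerCentral k) ⊤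

variable (F L) in
/-- The derived series `L, [L, L], [[L, L], [L, L]], …`, indexed from `0`. -/
def derivedSeq : ℕ → Submodule F L
  | 0 => ⊤
  | k + 1 => commutator (derivedSeq k) (derivedSeq k)

variable (F L) in
/-- Nilpotency: the lower central series reaches zero. -/
def IsNilpotentAlg : Prop := ∃ n, lowerCentral F L n = ⊥

variable (F L) in
/-- Solvability: the derived series reaches zero. -/
def IsSolvableAlg : Prop := ∃ n, derivedSeq F L n = ⊥

/-- `N` is a nilradical of `L`: a maximal one among the two-sided ideals of `L` that are nilpotent
(as Leibniz algebras in their own right). -/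
structure IsNilradical (N : LeibnizIdeal F L) : Prop where
  nilpotent : IsNilpotentAlg F N.toSubmodule
  maximal : ∀ J : LeibnizIdeal F L, IsNilpotentAlg F J.toSubmodule →
    N.toSubmodule ≤ J.toSubmodule → J.toSubmodule ≤ N.toSubmodule

/-- Derivations: linear maps with `d [x, y] = [d x, y] + [x, d y]`. -/
def IsDerivation (d : Module.End F L) : Prop :=
  ∀ x y : L, d ⁅x, y⁆ = ⁅d x, y⁆ + ⁅x, d y⁆

/-- Nil-independence: the only nilpotent linear combination of the family is the one with all
coefficients zero. -/
def NilIndependent {n : ℕ} (d : Fin n → Module.End F L) : Prop :=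
  ∀ α : Fin n → F, IsNilpotent (∑ i, α i • d i) → ∀ i, α i = 0

variable (F L) in
/-- The set of all `n` such that `L` has `n` nil-independent derivations. -/
def nilIndependentSizes : Set ℕ :=
  {n | ∃ d : Fin n → Module.End F L, (∀ i, IsDerivation (d i)) ∧ NilIndependent d}

variable [LeibnizAlgebra F L]

variable (F) in
/-- The right multiplication operator `y ↦ [y, x]`. -/
def rightMul (x : L) : Module.End F L where
  toFun y := ⁅y, x⁆
  map_add' y z := LeibnizRing.add_bracket y z x
  map_smul' c y := LeibnizAlgebra.smul_bracket c y x

/-- The restriction of the right multiplication by `x ∈ L` to an ideal `N`. -/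
def rightMulOn (N : LeibnizIdeal F L) (x : L) : Module.End F N.toSubmodule :=
  (rightMul F x).restrict fun _ hy => N.bracket_mem_left x hy

end

end LeibnizAlgebra

-- The key claim is that any `x` acting nilpotently on `N` from the right lies in `N`. Right
-- multiplications form a solvable Lie algebra. By Lie's theorem over the algebraic closure, those
-- that are nilpotent form a subspace containing all brackets; its preimage `S` is an ideal
-- containing `N` and `[R, R]`. Engel's theorem makes `S` nilpotent, so `S = N` by maximality. As
-- `[R, x]` lies in `N`, nilpotency of `x` on `N` lifts to `R`, whence `x ∈ N`. So a basis of `Q`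
-- gives nil-independent derivations. Nil-independence implies linear independence, which bounds the
-- sizes and yields a maximum.

attribute [local instance] LieRing.ofAssociativeRing

/-! ### Nilpotent action of solvable Lie algebras -/

namespace LieModule

open scoped TensorProduct

/-- If `L` acts on `W ≤ M` through the scalars `χ`, then `x` acts nilpotently on `M` exactly when
`χ x = 0` and `x` acts nilpotently on `M ⧸ W`. -/
theorem isNilpotent_toEnd_iff_of_le_weightSpace {K L M : Type*} [Field K] [LieRing L]
    [LieAlgebra K L] [AddCommGroup M] [Module K M] [LieRingModule L M] [LieModule K L M]
    (χ : L → K) (W : LieSubmodule K L M) [Nontrivial W] (hW : ∀ w ∈ W, ∀ x : L, ⁅x, w⁆ = χ x • w)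
    (x : L) :
    _root_.IsNilpotent (toEnd K L M x) ↔ χ x = 0 ∧ _root_.IsNilpotent (toEnd K L (M ⧸ W) x) := by
  have hmk (n : ℕ) (m : M) : ((toEnd K L (M ⧸ W) x) ^ n) (LieSubmodule.Quotient.mk' W m) =
      LieSubmodule.Quotient.mk' W (((toEnd K L M x) ^ n) m) := by
    induction n with
    | zero => simp
    | succ n ih => rw [pow_succ', pow_succ', Module.End.mul_apply, Module.End.mul_apply, ih]; rfl
  constructor
  · rintro ⟨n, hn⟩
    refine ⟨?_, n, ?_⟩
    · obtain ⟨⟨w, hw⟩, hw0⟩ := exists_ne (0 : W)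
      have hw0 : w ≠ 0 := fun h => hw0 (Subtype.ext h)
      have hp (k : ℕ) : ((toEnd K L M x) ^ k) w = (χ x) ^ k • w := by
        induction k with
        | zero => simp
        | succ k ih =>
          rw [pow_succ', Module.End.mul_apply, ih, map_smul, toEnd_apply_apply, hW w hw, smul_smul,
            ← pow_succ]
      have h := hp n
      rw [hn, LinearMap.zero_apply] at h
      exact eq_zero_of_pow_eq_zero ((smul_eq_zero.mp h.symm).resolve_right hw0)
    · ext m
      obtain ⟨m, rfl⟩ := LieSubmodule.Quotient.surjective_mk' W m
      rw [hmk, hn]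
      simp
  · rintro ⟨hχ, n, hn⟩
    refine ⟨n + 1, LinearMap.ext fun m => ?_⟩
    have hm : ((toEnd K L M x) ^ n) m ∈ W := by
      rw [← LieSubmodule.Quotient.mk'_ker W, LieModuleHom.mem_ker, ← hmk, hn, LinearMap.zero_apply]
    rw [pow_succ', Module.End.mul_apply, toEnd_apply_apply, hW _ hm, hχ, zero_smul,
      LinearMap.zero_apply]

/-- Over an algebraically closed field of characteristic zero, the elements of a solvable Lie
algebra acting nilpotently on a finite-dimensional module form a subspace containing all
brackets. -/
theorem exists_submodule_mem_iff_isNilpotent_toEnd_of_isAlgClosed {K L : Type*} [Field K]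
    [CharZero K] [IsAlgClosed K] [LieRing L] [LieAlgebra K L] [LieAlgebra.IsSolvable L]
    (M : Type*) [AddCommGroup M] [Module K M] [LieRingModule L M] [LieModule K L M]
    [FiniteDimensional K M] :
    ∃ I : Submodule K L, (∀ x y : L, ⁅x, y⁆ ∈ I) ∧ ∀ x, x ∈ I ↔ _root_.IsNilpotent (toEnd K L M x) := by
  induction hd : Module.finrank K M using Nat.strong_induction_on generalizing M with
  | _ d ih =>
  rcases subsingleton_or_nontrivial M with _ | _
  · exact ⟨⊤, fun _ _ => trivial, fun x =>
      ⟨fun _ => ⟨0, LinearMap.ext fun m => Subsingleton.elim _ _⟩, fun _ => trivial⟩⟩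
  obtain ⟨χ, hχ⟩ := exists_nontrivial_weightSpace_of_isSolvable K L M
  let W : LieSubmodule K L M := weightSpace M χ
  have hW : ∀ w ∈ W, ∀ x : L, ⁅x, w⁆ = χ x • w := fun w hw => (mem_weightSpace χ w).mp hw
  have hrank : Module.finrank K (M ⧸ W) < d := by
    have h1 := Submodule.finrank_quotient_add_finrank W.toSubmodule
    have h2 : 0 < Module.finrank K W.toSubmodule :=
      have : Nontrivial W.toSubmodule := hχ
      Module.finrank_pos
    change Module.finrank K (M ⧸ W.toSubmodule) < d
    omega
  obtain ⟨I, hI, hI'⟩ := ih _ hrank (M ⧸ W) rfl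
  -- In triangular form: `χ` is one diagonal weight, and `I` collects the conditions from the
  -- quotient.
  refine ⟨LinearMap.ker χ ⊓ I, fun x y => ⟨?_, hI x y⟩, fun x => ?_⟩
  · obtain ⟨⟨w, hw⟩, hw0⟩ := exists_ne (0 : W)
    have hw0 : w ≠ 0 := fun h => hw0 (Subtype.ext h)
    have h := hW w hw ⁅x, y⁆
    rw [lie_lie, hW w hw, hW w hw, lie_smul, lie_smul, hW w hw, hW w hw, smul_comm, sub_self] at h
    exact (smul_eq_zero.mp h.symm).resolve_right hw0
  · rw [isNilpotent_toEnd_iff_of_le_weightSpace χ W hW, ← hI']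
    rfl

/-- Over a field of characteristic zero, the elements of a solvable Lie algebra acting nilpotently
on a finite-dimensional module form a subspace containing all brackets. -/
theorem exists_submodule_mem_iff_isNilpotent_toEnd (F L M : Type*) [Field F] [CharZero F]
    [LieRing L] [LieAlgebra F L] [LieAlgebra.IsSolvable L] [AddCommGroup M] [Module F M]
    [LieRingModule L M] [LieModule F L M] [FiniteDimensional F M] :
    ∃ I : Submodule F L, (∀ x y : L, ⁅x, y⁆ ∈ I) ∧ ∀ x, x ∈ I ↔ _root_.IsNilpotent (toEnd F L M x) := by
  let K := AlgebraicClosure F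
  obtain ⟨I, hI, hI'⟩ := exists_submodule_mem_iff_isNilpotent_toEnd_of_isAlgClosed
    (K := K) (L := K ⊗[F] L) (K ⊗[F] M)
  refine ⟨(I.restrictScalars F).comap (TensorProduct.mk F K L 1), fun x y => ?_, fun x => ?_⟩
  · have h := hI ((1 : K) ⊗ₜ[F] x) ((1 : K) ⊗ₜ[F] y)
    rwa [LieAlgebra.ExtendScalars.bracket_tmul, one_mul] at h
  -- Base change of endomorphisms is an injective ring homomorphism, so it detects nilpotency.
  · have hinj : Function.Injective (Module.End.baseChangeHom F K M) :=
      LinearMap.baseChangeHom_injective F M K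
    rw [← IsNilpotent.map_iff hinj]
    change (1 : K) ⊗ₜ[F] x ∈ I ↔ _root_.IsNilpotent ((toEnd F L M x).baseChange K)
    rw [← toEnd_baseChange, hI']

end LieModule

/-! ### Derivations and right multiplications -/

namespace LeibnizAlgebra

theorem NilIndependent.linearIndependent {F L : Type*} [Field F] [LeibnizRing L] [Module F L]
    {n : ℕ} {d : Fin n → Module.End F L} (hd : NilIndependent d) : LinearIndependent F d :=
  Fintype.linearIndependent_iff.mpr fun α hα => hd α (hα ▸ IsNilpotent.zero)

theorem bddAbove_nilIndependentSizes {F L : Type*} [Field F] [LeibnizRing L] [Module F L]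
    [FiniteDimensional F L] :
    BddAbove (nilIndependentSizes F L) := by
  refine ⟨Module.finrank F (Module.End F L), ?_⟩
  rintro n ⟨d, -, hd⟩
  simpa using hd.linearIndependent.fintype_card_le_finrank

variable {F L : Type*} [Field F] [LeibnizRing L] [Module F L] [LeibnizAlgebra F L]

theorem rightMul_apply (x y : L) : rightMul F x y = ⁅y, x⁆ := rfl

theorem isDerivation_rightMulOn (N : LeibnizIdeal F L) (x : L) :
    IsDerivation (rightMulOn N x) := fun y z => Subtype.ext <| by
  change ⁅⁅(y : L), (z : L)⁆, x⁆ = ⁅⁅(y : L), x⁆, (z : L)⁆ + ⁅(y : L), ⁅(z : L), x⁆⁆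
  rw [LeibnizRing.leibniz_identity]
  abel

/-- Right multiplication, as a linear map into the endomorphisms. -/
def rightMulLinear (F L : Type*) [Field F] [LeibnizRing L] [Module F L] [LeibnizAlgebra F L] :
    L →ₗ[F] Module.End F L where
  toFun := rightMul F
  map_add' x y := LinearMap.ext fun z => LeibnizRing.bracket_add z x y
  map_smul' c x := LinearMap.ext fun z => LeibnizAlgebra.bracket_smul c z x

/-- Left multiplication by `x`. -/
def leftMul (F : Type*) {L : Type*} [Field F] [LeibnizRing L] [Module F L] [LeibnizAlgebra F L]
    (x : L) : Module.End F L :=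
  (rightMulLinear F L).flip x

/-- The restriction of right multiplication to an ideal, as a linear map into the
endomorphisms. -/
def rightMulOnLinear (N : LeibnizIdeal F L) : L →ₗ[F] Module.End F N.toSubmodule where
  toFun := rightMulOn N
  map_add' x y := LinearMap.ext fun z => Subtype.ext (LeibnizRing.bracket_add (z : L) x y)
  map_smul' c x := LinearMap.ext fun z => Subtype.ext (LeibnizAlgebra.bracket_smul c (z : L) x)

theorem rightMul_bracket (x y : L) : rightMul F ⁅x, y⁆ = ⁅rightMul F y, rightMul F x⁆ :=
  LinearMap.ext fun z => LeibnizRing.leibniz_identity z x y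

/-- The Lie algebra of right multiplications of a Leibniz algebra. -/
def rightMulLie (F L : Type*) [Field F] [LeibnizRing L] [Module F L] [LeibnizAlgebra F L] :
    LieSubalgebra F (Module.End F L) where
  __ := LinearMap.range (rightMulLinear F L)
  lie_mem' := by
    rintro _ _ ⟨x, rfl⟩ ⟨y, rfl⟩
    exact ⟨⁅y, x⁆, rightMul_bracket y x⟩

/-- Right multiplication by `x`, as an element of the Lie algebra of right multiplications. -/
def rightMulLie.mk (F : Type*) {L : Type*} [Field F] [LeibnizRing L] [Module F L]
    [LeibnizAlgebra F L] (x : L) : rightMulLie F L := ⟨rightMul F x, x, rfl⟩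

/-- Right multiplication reverses brackets, which is harmless because `commutator` contains both
orders. -/
theorem derivedSeries_rightMulLie_le (k : ℕ) {a : rightMulLie F L}
    (ha : a ∈ LieAlgebra.derivedSeries F (rightMulLie F L) k) :
    ∃ x ∈ derivedSeq F L k, rightMulLie.mk F x = a := by
  induction k generalizing a with
  | zero =>
    obtain ⟨_, x, rfl⟩ := a
    exact ⟨x, trivial, rfl⟩
  | succ k ih =>
    rw [LieAlgebra.derivedSeries_def, LieAlgebra.derivedSeriesOfIdeal_succ,
      ← LieSubmodule.mem_toSubmodule, LieSubmodule.lieIdeal_oper_eq_linear_span'] at ha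
    induction ha using Submodule.span_induction with
    | mem a ha =>
      obtain ⟨b, hb, c, hc, rfl⟩ := ha
      obtain ⟨x, hx, rfl⟩ := ih hb
      obtain ⟨y, hy, rfl⟩ := ih hc
      exact ⟨⁅y, x⁆, Submodule.subset_span ⟨x, hx, y, hy, Or.inr rfl⟩,
        Subtype.ext (rightMul_bracket y x)⟩
    | zero => exact ⟨0, zero_mem _, Subtype.ext (map_zero (rightMulLinear F L))⟩
    | add a b _ _ ha hb =>
      obtain ⟨x, hx, rfl⟩ := ha
      obtain ⟨y, hy, rfl⟩ := hb
      exact ⟨x + y, add_mem hx hy, Subtype.ext (map_add (rightMulLinear F L) x y)⟩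
    | smul c a _ ha =>
      obtain ⟨x, hx, rfl⟩ := ha
      exact ⟨c • x, Submodule.smul_mem _ c hx, Subtype.ext (map_smul (rightMulLinear F L) c x)⟩

theorem isSolvable_rightMulLie (h : IsSolvableAlg F L) :
    LieAlgebra.IsSolvable (rightMulLie F L) := by
  obtain ⟨k, hk⟩ := h
  refine LieAlgebra.IsSolvable.mk (R := F) (k := k) ((LieSubmodule.eq_bot_iff _).mpr ?_)
  intro a ha
  obtain ⟨x, hx, rfl⟩ := derivedSeries_rightMulLie_le k ha
  rw [hk, Submodule.mem_bot] at hx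
  exact Subtype.ext (hx ▸ map_zero (rightMulLinear F L))

/-! ### Engel's theorem -/

/-- The lower central series of `L` as a module over its right multiplications. -/
def rightSeries (F L : Type*) [Field F] [LeibnizRing L] [Module F L] [LeibnizAlgebra F L]
    (k : ℕ) : Submodule F L :=
  (LieModule.lowerCentralSeries F (rightMulLie F L) L k).toSubmodule

theorem rightSeries_succ (k : ℕ) :
    rightSeries F L (k + 1) = Submodule.span F {z | ∃ x ∈ rightSeries F L k, ∃ y, ⁅x, y⁆ = z} := by
  rw [rightSeries, LieModule.lowerCentralSeries_succ, LieSubmodule.lieIdeal_oper_eq_linear_span']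
  congr 1
  ext z
  constructor
  · rintro ⟨⟨_, y, rfl⟩, -, x, hx, rfl⟩
    exact ⟨x, hx, y, rfl⟩
  · rintro ⟨x, hx, y, rfl⟩
    exact ⟨rightMulLie.mk F y, trivial, x, hx, rfl⟩

/-- The Leibniz identity trades a right factor `[y, z]` for successive right multiplications by `y`
and `z`, so induction on `j` applies. The case `i = 0` controls left multiplication, which the
series does not mention. -/
theorem bracket_mem_rightSeries {i j : ℕ} {x y : L} (hx : x ∈ rightSeries F L i)
    (hy : y ∈ rightSeries F L j) : ⁅x, y⁆ ∈ rightSeries F L (i + j + 1) := by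
  have step {i : ℕ} {x : L} (hx : x ∈ rightSeries F L i) (y : L) :
      ⁅x, y⁆ ∈ rightSeries F L (i + 1) := by
    rw [rightSeries_succ]
    exact Submodule.subset_span ⟨x, hx, y, rfl⟩
  induction j generalizing i x y with
  | zero => exact step hx y
  | succ j ih =>
    rw [rightSeries_succ] at hy
    refine (Submodule.span_le (p := (rightSeries F L (i + (j + 1) + 1)).comap
      (leftMul F x))).mpr ?_ hy
    rintro _ ⟨y, hy, z, rfl⟩
    change ⁅x, ⁅y, z⁆⁆ ∈ rightSeries F L (i + (j + 1) + 1)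
    rw [LeibnizRing.leibniz_identity]
    refine sub_mem (step (ih hx hy) z) ?_
    have h := ih (step hx z) hy
    rwa [show i + 1 + j + 1 = i + (j + 1) + 1 by omega] at h

theorem lowerCentral_le_rightSeries (k : ℕ) : lowerCentral F L k ≤ rightSeries F L k := by
  induction k with
  | zero => exact le_rfl
  | succ k ih =>
    refine Submodule.span_le.mpr ?_
    rintro _ ⟨x, hx, y, -, rfl | rfl⟩
    · exact bracket_mem_rightSeries (j := 0) (ih hx) trivial
    · have h := bracket_mem_rightSeries (F := F) (i := 0) (x := y) trivial (ih hx)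
      rwa [zero_add] at h

/-- Engel's theorem for Leibniz algebras. -/
theorem isNilpotentAlg_of_isNilpotent_rightMul [FiniteDimensional F L]
    (h : ∀ x : L, IsNilpotent (rightMul F x)) : IsNilpotentAlg F L := by
  have : LieModule.IsNilpotent (rightMulLie F L) L := by
    rw [LieModule.isNilpotent_iff_forall' (R := F)]
    rintro ⟨_, x, rfl⟩
    exact h x
  obtain ⟨k, hk⟩ := LieModule.IsNilpotent.nilpotent F (rightMulLie F L) L
  refine ⟨k, le_bot_iff.mp ((lowerCentral_le_rightSeries k).trans ?_)⟩
  rw [rightSeries, hk]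
  exact le_rfl

/-! ### The nilradical of a solvable Leibniz algebra -/

/-- An ideal that is nilpotent in its own right acts nilpotently on the whole algebra. -/
theorem isNilpotent_rightMul_of_mem (N : LeibnizIdeal F L)
    (hN : IsNilpotentAlg F N.toSubmodule) {x : L} (hx : x ∈ N.toSubmodule) :
    IsNilpotent (rightMul F x) := by
  obtain ⟨n, hn⟩ := hN
  -- The extra application in `k + 1` moves `y` into `N`.
  have key (k : ℕ) (y : L) : ∃ z ∈ lowerCentral F N.toSubmodule k,
      (z : L) = ((rightMul F x) ^ (k + 1)) y := by
    induction k with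
    | zero =>
      exact ⟨⟨⁅y, x⁆, N.bracket_mem_right y hx⟩, trivial, by rw [zero_add, pow_one]; rfl⟩
    | succ k ih =>
      obtain ⟨z, hz, hzy⟩ := ih
      refine ⟨⁅z, ⟨x, hx⟩⁆, Submodule.subset_span ⟨z, hz, _, trivial, Or.inl rfl⟩, ?_⟩
      rw [pow_succ', Module.End.mul_apply, ← hzy]
      rfl
  refine ⟨n + 1, LinearMap.ext fun y => ?_⟩
  obtain ⟨z, hz, hzy⟩ := key n y
  rw [hn, Submodule.mem_bot] at hz
  rw [← hzy, hz]
  rfl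

theorem exists_leibnizIdeal_mem_iff_isNilpotent_rightMul [CharZero F] [FiniteDimensional F L]
    (h : IsSolvableAlg F L) :
    ∃ S : LeibnizIdeal F L, (∀ x y : L, ⁅x, y⁆ ∈ S.toSubmodule) ∧
      ∀ x, x ∈ S.toSubmodule ↔ IsNilpotent (rightMul F x) := by
  have := isSolvable_rightMulLie h
  obtain ⟨I, hI, hI'⟩ := LieModule.exists_submodule_mem_iff_isNilpotent_toEnd F (rightMulLie F L) L
  have hb (x y : L) : rightMulLie.mk F ⁅x, y⁆ ∈ I := by
    have h := hI (rightMulLie.mk F y) (rightMulLie.mk F x)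
    rwa [show ⁅rightMulLie.mk F y, rightMulLie.mk F x⁆ = rightMulLie.mk F ⁅x, y⁆ from
      Subtype.ext (rightMul_bracket x y).symm] at h
  let S : Submodule F L := I.comap ((rightMulLinear F L).rangeRestrict)
  exact ⟨⟨S, fun x y _ => hb x y, fun y _ => hb _ y⟩, hb, fun x => hI' (rightMulLie.mk F x)⟩

/-- The nilradical of a solvable Leibniz algebra contains all brackets and all elements whose right
multiplication is nilpotent. -/
theorem IsNilradical.bracket_mem_and_mem_of_isNilpotent [CharZero F] [FiniteDimensional F L]
    (h : IsSolvableAlg F L) {N : LeibnizIdeal F L} (hN : IsNilradical N) :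
    (∀ x y : L, ⁅x, y⁆ ∈ N.toSubmodule) ∧
      ∀ x, IsNilpotent (rightMul F x) → x ∈ N.toSubmodule := by
  obtain ⟨S, hS, hS'⟩ := exists_leibnizIdeal_mem_iff_isNilpotent_rightMul h
  have hSN : S.toSubmodule ≤ N.toSubmodule := by
    refine hN.maximal S (isNilpotentAlg_of_isNilpotent_rightMul fun x => ?_) fun x hx =>
      (hS' x).mpr (isNilpotent_rightMul_of_mem N hN.nilpotent hx)
    exact Module.End.isNilpotent.restrict (fun y hy => S.bracket_mem_left (x : L) hy)
      ((hS' (x : L)).mp x.2)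
  exact ⟨fun x y => hSN (hS x y), fun x hx => hSN ((hS' x).mpr hx)⟩

theorem IsNilradical.mem_of_isNilpotent_rightMulOn [CharZero F] [FiniteDimensional F L]
    (h : IsSolvableAlg F L) {N : LeibnizIdeal F L} (hN : IsNilradical N) {x : L}
    (hx : IsNilpotent (rightMulOn N x)) : x ∈ N.toSubmodule := by
  obtain ⟨hb, hmem⟩ := hN.bracket_mem_and_mem_of_isNilpotent h
  obtain ⟨n, hn⟩ := hx
  -- One application lands in `N` because `N` contains all brackets; the other `n` act within `N`.
  refine hmem x ⟨n + 1, LinearMap.ext fun y => ?_⟩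
  have hpow (k : ℕ) (z : N.toSubmodule) :
      (((rightMulOn N x) ^ k) z : L) = ((rightMul F x) ^ k) (z : L) := by
    induction k with
    | zero => rfl
    | succ k ih =>
      rw [pow_succ', pow_succ', Module.End.mul_apply, Module.End.mul_apply, ← ih]
      rfl
  have h := hpow n ⟨⁅y, x⁆, hb y x⟩
  rw [hn] at h
  rw [pow_succ, Module.End.mul_apply]
  exact h.symm

end LeibnizAlgebra

/-! ### The main theorem -/

theorem theorem3p1 {F R : Type*} [Field F] [CharZero F] [LeibnizRing R] [Module F R]
    [LeibnizAlgebra F R] [FiniteDimensional F R]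
    (hR : LeibnizAlgebra.IsSolvableAlg F R)
    (N : LeibnizIdeal F R) (hN : LeibnizAlgebra.IsNilradical N)
    (Q : Submodule F R) (hQ : IsCompl N.toSubmodule Q) :
    (∃ m : ℕ, IsGreatest (LeibnizAlgebra.nilIndependentSizes F N.toSubmodule) m ∧
      Module.finrank F Q ≤ m) ∧
    (∀ x ∈ Q, x ≠ 0 →
      LeibnizAlgebra.IsDerivation (LeibnizAlgebra.rightMulOn N x) ∧
      ¬ IsNilpotent (LeibnizAlgebra.rightMulOn N x)) := by
  have hmem : ∀ x ∈ Q, IsNilpotent (LeibnizAlgebra.rightMulOn N x) → x = 0 := fun x hx hnil =>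
    Submodule.disjoint_def.mp hQ.disjoint x (hN.mem_of_isNilpotent_rightMulOn hR hnil) hx
  refine ⟨?_, fun x hx hx0 =>
    ⟨LeibnizAlgebra.isDerivation_rightMulOn N x, fun hnil => hx0 (hmem x hx hnil)⟩⟩
  have hQmem : Module.finrank F Q ∈ LeibnizAlgebra.nilIndependentSizes F N.toSubmodule := by
    let b := Module.finBasis F Q
    refine ⟨fun i => LeibnizAlgebra.rightMulOn N (b i : R),
      fun i => LeibnizAlgebra.isDerivation_rightMulOn N _, fun α hα => ?_⟩
    -- A combination of the derivations is again the action of a single element of `Q`, to which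
    -- `hmem` applies.
    have hsum : ∑ i, α i • LeibnizAlgebra.rightMulOn N (b i : R) =
        LeibnizAlgebra.rightMulOn N ((∑ i, α i • b i : Q) : R) := by
      have h := map_sum (LeibnizAlgebra.rightMulOnLinear N ∘ₗ Q.subtype) (fun i => α i • b i)
        Finset.univ
      simp only [map_smul] at h
      exact h.symm
    rw [hsum] at hα
    exact Fintype.linearIndependent_iff.mp b.linearIndependent α
      (Subtype.ext (hmem _ (Subtype.prop _) hα))
  have hbdd := LeibnizAlgebra.bddAbove_nilIndependentSizes (F := F) (L := N.toSubmodule)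
  exact ⟨_, ⟨Nat.sSup_mem ⟨_, hQmem⟩ hbdd, fun _ h => le_csSup hbdd h⟩, le_csSup hbdd hQmem⟩
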